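/- Let $R=\mathbb{Z}_3[v]/\langle v^3-v\rangle$, let $n\ge 1$, and let $C\subseteq R^n$ be a cyclic or negacyclic linear code (an $R$-submodule of $R^n$ closed under $(c_0,\dots,c_{n-1})\mapsto(c_{n-1},c_0,\dots,c_{n-2})$, respectively under $(c_0,\dots,c_{n-1})\mapsto(-c_{n-1},c_0,\dots,c_{n-2})$) of type $27^{k_1}9^{k_2}3^{k_3}$, that is, $|C|=27^{k_1}9^{k_2}3^{k_3}$. Put $C_1=\{a\in\mathbb{Z}_3^n: a+vb+v^2c\in C\text{ for some }b,c\in\mathbb{Z}_3^n\}$, $C_2=\{a+b+c: a,b,c\in\mathbb{Z}_3^n,\ a+vb+v^2c\in C\}$, $C_3=\{a+2b+c: a,b,c\in\mathbb{Z}_3^n,\ a+vb+v^2c\in C\}$, so that $C=(1+2v^2)C_1\oplus(2v+2v^2)C_2\oplus(v+2v^2)C_3$. Let $\phi:R^n\to\mathbb{Z}_3^{3n}$, $\phi(a+vb+v^2c)=(a\,|\,a+b+c\,|\,a+2b+c)$, be the Gray map, and let $d_L$ be the minimum Lee weight of $C$, the Lee weight of $x\in R^n$ being the Hamming weight of $\phi(x)$.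 Let $\perp$ denote the dual code with respect to the standard bilinear form $x\cdot y=\sum_i x_iy_i$. If $C_i^\perp\subseteq C_i$ for $i=1,2,3$, then $C^\perp\subseteq C$, and there exists a quantum error-correcting code with parameters $[[3n,\;2(3k_1+2k_2+k_3)-3n,\;d_L]]_3$ (where $2(3k_1+2k_2+k_3)\ge 3n$). Such a code is the CSS code of the Gray image $D=\phi(C)$, which satisfies $D^\perp\subseteq D$: the subspace of $(\mathbb{C}^3)^{\otimes 3n}$ spanned by the states $\sum_{u\in D^\perp}|x+u\rangle$, $x\in D$. Here an $[[N,k,d]]_3$ code is a subspace of $(\mathbb{C}^3)^{\otimes N}$ of dimension $3^k$, with orthogonal projection $P$, such that for every operator $E$ acting on fewer than $d$ of the $N$ qutrits one has $PEP=c_EP$ for some scalar $c_E$; if $k=0$ it is moreover required that $c_E=\operatorname{tr}(E)/3^N$. -/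

import Mathlib

open Polynomial

noncomputable section

/-! ### The ring `R = Z₃ + vZ₃ + v²Z₃`, `v³ = v` -/

/-- The ring `R = Z₃[v] / ⟨v³ - v⟩`. -/
abbrev RingR : Type := AdjoinRoot (X ^ 3 - X : (ZMod 3)[X])

/-- The element `v` of `R`. -/
def vR : RingR := AdjoinRoot.root (X ^ 3 - X : (ZMod 3)[X])

/-- The element `a + v b + v² c` of `R`. -/
def elemR (a b c : ZMod 3) : RingR :=
  algebraMap (ZMod 3) RingR a + vR * algebraMap (ZMod 3) RingR b
    + vR ^ 2 * algebraMap (ZMod 3) RingR c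

theorem monic_modulus : (X ^ 3 - X : (ZMod 3)[X]).Monic := by
  monicity!

theorem vR_cube : vR ^ 3 = vR := by
  have h := AdjoinRoot.mk_self (f := (X ^ 3 - X : (ZMod 3)[X]))
  rw [map_sub, map_pow, AdjoinRoot.mk_X] at h
  exact sub_eq_zero.mp h

/-- `coordR j r` is the coefficient of `v ^ j` in `r = a + v b + v² c` (for `j = 0, 1, 2`). -/
def coordR (j : ℕ) : RingR →ₗ[ZMod 3] ZMod 3 :=
  (Polynomial.lcoeff (ZMod 3) j).comp (AdjoinRoot.modByMonicHom monic_modulus)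

theorem elemR_coord (r : RingR) : elemR (coordR 0 r) (coordR 1 r) (coordR 2 r) = r := by
  conv_rhs => rw [← AdjoinRoot.mk_leftInverse monic_modulus r]
  have hd : (AdjoinRoot.modByMonicHom monic_modulus r).natDegree < 3 := by
    obtain ⟨p, rfl⟩ := AdjoinRoot.mk_surjective r
    rw [AdjoinRoot.modByMonicHom_mk]
    have h3 : (X ^ 3 - X : (ZMod 3)[X]).natDegree = 3 := by compute_degree!
    have h := Polynomial.natDegree_modByMonic_lt p monic_modulus
      (fun h1 => by rw [h1] at h3; simp at h3)
    omega
  have hs := Polynomial.as_sum_range' (AdjoinRoot.modByMonicHom monic_modulus r) 3 hd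
  conv_rhs => rw [hs]
  simp only [Finset.sum_range_succ, Finset.sum_range_zero, ← Polynomial.C_mul_X_pow_eq_monomial,
    map_add, map_mul, map_pow, AdjoinRoot.mk_X, AdjoinRoot.mk_C]
  simp [elemR, coordR, vR, AdjoinRoot.algebraMap_eq, mul_comm]

theorem coordR_elemR (a b c : ZMod 3) :
    coordR 0 (elemR a b c) = a ∧ coordR 1 (elemR a b c) = b ∧ coordR 2 (elemR a b c) = c := by
  have h : elemR a b c = AdjoinRoot.mk (X ^ 3 - X : (ZMod 3)[X]) (C a + X * C b + X ^ 2 * C c) := by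
    simp only [elemR, vR, AdjoinRoot.algebraMap_eq, map_add, map_mul, map_pow, AdjoinRoot.mk_X,
      AdjoinRoot.mk_C]
  have hm : (C a + X * C b + X ^ 2 * C c) %ₘ (X ^ 3 - X : (ZMod 3)[X])
      = C a + X * C b + X ^ 2 * C c := by
    rw [Polynomial.modByMonic_eq_self_iff monic_modulus]
    have h1 : (X ^ 3 - X : (ZMod 3)[X]).degree = 3 := by compute_degree!
    rw [h1]
    refine lt_of_le_of_lt (b := 2) ?_ (by norm_num)
    compute_degree
  rw [h]
  simp only [coordR, LinearMap.comp_apply, AdjoinRoot.modByMonicHom_mk, hm,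
    Polynomial.lcoeff_apply]
  simp [Polynomial.coeff_X, Polynomial.coeff_C, Polynomial.coeff_X_pow]

/-! ### Linear codes, duals, cyclic and negacyclic codes -/

/-- The Euclidean dual `{x : ∀ y ∈ C, x · y = 0}` of a linear code over a commutative ring. -/
def dualCode {A : Type*} [CommRing A] {m : ℕ} (C : Submodule A (Fin m → A)) :
    Submodule A (Fin m → A) where
  carrier := {x | ∀ y ∈ C, x ⬝ᵥ y = 0}
  zero_mem' := by intro y _; simp
  add_mem' := by
    intro x x' hx hx' y hy
    rw [add_dotProduct, hx y hy, hx' y hy, add_zero]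
  smul_mem' := by
    intro r x hx y hy
    rw [smul_dotProduct, hx y hy, smul_zero]

/-- The shift `(c₀, …, c_{n-1}) ↦ (l c_{n-1}, c₀, …, c_{n-2})`
(in `Fin n` one has `0 - 1 = n - 1`). -/
def constaShift {A : Type*} [CommRing A] {n : ℕ} [NeZero n] (l : A) (c : Fin n → A) : Fin n → A :=
  fun i => if i = 0 then l * c (i - 1) else c (i - 1)

/-- A linear code is cyclic if it is closed under the cyclic shift. -/
def IsCyclicCode {A : Type*} [CommRing A] {n : ℕ} [NeZero n] (C : Submodule A (Fin n → A)) : Prop :=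
  ∀ c ∈ C, constaShift 1 c ∈ C

/-- A linear code is negacyclic if it is closed under the negacyclic shift. -/
def IsNegacyclicCode {A : Type*} [CommRing A] {n : ℕ} [NeZero n] (C : Submodule A (Fin n → A)) :
    Prop :=
  ∀ c ∈ C, constaShift (-1) c ∈ C

/-! ### The ternary codes `C₁, C₂, C₃` of a linear code over `R` -/

/-- The vector `a + v b + v² c` of `R ^ n`. -/
def vecR {n : ℕ} (a b c : Fin n → ZMod 3) : Fin n → RingR := fun i => elemR (a i) (b i) (c i)

theorem vecR_zero {n : ℕ} : vecR (0 : Fin n → ZMod 3) 0 0 = 0 := by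
  funext i; simp [vecR, elemR]

theorem vecR_add {n : ℕ} (a b c a' b' c' : Fin n → ZMod 3) :
    vecR (a + a') (b + b') (c + c') = vecR a b c + vecR a' b' c' := by
  funext i; simp [vecR, elemR]; ring

theorem vecR_smul {n : ℕ} (t : ZMod 3) (a b c : Fin n → ZMod 3) :
    vecR (t • a) (t • b) (t • c) = algebraMap (ZMod 3) RingR t • vecR a b c := by
  funext i; simp [vecR, elemR]; ring

/-- `C₁ = {a : a + v b + v² c ∈ C for some b, c}`. -/
def code1 {n : ℕ} (C : Submodule RingR (Fin n → RingR)) :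
    Submodule (ZMod 3) (Fin n → ZMod 3) where
  carrier := {a | ∃ b c, vecR a b c ∈ C}
  zero_mem' := ⟨0, 0, by rw [vecR_zero]; exact C.zero_mem⟩
  add_mem' := by
    rintro _ _ ⟨b, c, h⟩ ⟨b', c', h'⟩
    exact ⟨b + b', c + c', by rw [vecR_add]; exact C.add_mem h h'⟩
  smul_mem' := by
    rintro t _ ⟨b, c, h⟩
    exact ⟨t • b, t • c, by rw [vecR_smul]; exact C.smul_mem _ h⟩

/-- `C₂ = {a + b + c : a + v b + v² c ∈ C}`. -/
def code2 {n : ℕ} (C : Submodule RingR (Fin n → RingR)) :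
    Submodule (ZMod 3) (Fin n → ZMod 3) where
  carrier := {x | ∃ a b c, vecR a b c ∈ C ∧ x = a + b + c}
  zero_mem' := ⟨0, 0, 0, by rw [vecR_zero]; exact C.zero_mem, by simp⟩
  add_mem' := by
    rintro _ _ ⟨a, b, c, h, rfl⟩ ⟨a', b', c', h', rfl⟩
    exact ⟨_, _, _, by rw [vecR_add]; exact C.add_mem h h', by abel⟩
  smul_mem' := by
    rintro t _ ⟨a, b, c, h, rfl⟩
    exact ⟨t • a, t • b, t • c, by rw [vecR_smul]; exact C.smul_mem _ h, by simp only [smul_add]⟩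

/-- `C₃ = {a + 2 b + c : a + v b + v² c ∈ C}`. -/
def code3 {n : ℕ} (C : Submodule RingR (Fin n → RingR)) :
    Submodule (ZMod 3) (Fin n → ZMod 3) where
  carrier := {x | ∃ a b c, vecR a b c ∈ C ∧ x = a + (2 : ZMod 3) • b + c}
  zero_mem' := ⟨0, 0, 0, by rw [vecR_zero]; exact C.zero_mem, by simp⟩
  add_mem' := by
    rintro _ _ ⟨a, b, c, h, rfl⟩ ⟨a', b', c', h', rfl⟩
    exact ⟨_, _, _, by rw [vecR_add]; exact C.add_mem h h', by rw [smul_add]; abel⟩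
  smul_mem' := by
    rintro t _ ⟨a, b, c, h, rfl⟩
    exact ⟨t • a, t • b, t • c, by rw [vecR_smul]; exact C.smul_mem _ h,
      by simp only [smul_add, smul_comm t (2 : ZMod 3)]⟩

/-- The coordinatewise inclusion of `Z₃ ^ n` in `R ^ n`. -/
def inclR {n : ℕ} (x : Fin n → ZMod 3) : Fin n → RingR := fun i => algebraMap (ZMod 3) RingR (x i)

theorem three_R : (3 : RingR) = 0 := by
  have h : algebraMap (ZMod 3) RingR 3 = 0 := by
    rw [show (3 : ZMod 3) = 0 from rfl, map_zero]
  rwa [map_ofNat] at h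

/-- The decomposition `C = (1 + 2v²) C₁ ⊕ (2v + 2v²) C₂ ⊕ (v + 2v²) C₃`. -/
theorem mem_iff_decomposition {n : ℕ} (C : Submodule RingR (Fin n → RingR)) (w : Fin n → RingR) :
    w ∈ C ↔ ∃ x ∈ code1 C, ∃ y ∈ code2 C, ∃ z ∈ code3 C,
      w = (1 + 2 * vR ^ 2) • inclR x + (2 * vR + 2 * vR ^ 2) • inclR y
        + (vR + 2 * vR ^ 2) • inclR z := by
  have h3 := three_R
  have hv := vR_cube
  have e1 : ∀ a b c : Fin n → ZMod 3,
      (1 + 2 * vR ^ 2) • inclR a = (1 + 2 * vR ^ 2) • vecR a b c := by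
    intro a b c; funext i
    simp only [Pi.smul_apply, inclR, vecR, elemR, smul_eq_mul]
    generalize algebraMap (ZMod 3) RingR (a i) = A
    generalize algebraMap (ZMod 3) RingR (b i) = B
    generalize algebraMap (ZMod 3) RingR (c i) = D
    linear_combination (-(B * vR) - D * vR ^ 2) * h3 + (-2 * B - 2 * vR * D) * hv
  have e2 : ∀ a b c : Fin n → ZMod 3,
      (2 * vR + 2 * vR ^ 2) • inclR (a + b + c) = (2 * vR + 2 * vR ^ 2) • vecR a b c := by
    intro a b c; funext i
    simp only [Pi.smul_apply, Pi.add_apply, inclR, vecR, elemR, smul_eq_mul, map_add]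
    generalize algebraMap (ZMod 3) RingR (a i) = A
    generalize algebraMap (ZMod 3) RingR (b i) = B
    generalize algebraMap (ZMod 3) RingR (c i) = D
    linear_combination (-2 * B - 2 * D - 2 * vR * D) * hv
  have e3 : ∀ a b c : Fin n → ZMod 3,
      (vR + 2 * vR ^ 2) • inclR (a + (2 : ZMod 3) • b + c) = (vR + 2 * vR ^ 2) • vecR a b c := by
    intro a b c; funext i
    simp only [Pi.smul_apply, Pi.add_apply, inclR, vecR, elemR, smul_eq_mul, map_add, map_mul,
      map_ofNat]
    generalize algebraMap (ZMod 3) RingR (a i) = A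
    generalize algebraMap (ZMod 3) RingR (b i) = B
    generalize algebraMap (ZMod 3) RingR (c i) = D
    linear_combination (B * vR ^ 2) * h3 + (-2 * B - D - 2 * vR * D) * hv
  constructor
  · intro hw
    have hw' : vecR (fun i => coordR 0 (w i)) (fun i => coordR 1 (w i)) (fun i => coordR 2 (w i))
        = w := by
      funext i; exact elemR_coord (w i)
    refine ⟨_, ⟨_, _, by rw [hw']; exact hw⟩, _, ⟨_, _, _, by rw [hw']; exact hw, rfl⟩,
      _, ⟨_, _, _, by rw [hw']; exact hw, rfl⟩, ?_⟩
    rw [e1, e2, e3, hw', ← add_smul, ← add_smul]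
    have : (1 + 2 * vR ^ 2 + (2 * vR + 2 * vR ^ 2) + (vR + 2 * vR ^ 2) : RingR) = 1 := by
      linear_combination (vR + 2 * vR ^ 2) * h3
    rw [this, one_smul]
  · rintro ⟨a, ⟨b, c, h⟩, _, ⟨a', b', c', h', rfl⟩, _, ⟨a'', b'', c'', h'', rfl⟩, rfl⟩
    rw [e1 a b c, e2, e3]
    exact C.add_mem (C.add_mem (C.smul_mem _ h) (C.smul_mem _ h')) (C.smul_mem _ h'')

/-! ### Gray map and Lee weight -/

/-- The Gray map `a + v b + v² c ↦ (a, a + b + c, a + 2b + c)` on `R`. -/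
def gray : RingR →ₗ[ZMod 3] (Fin 3 → ZMod 3) :=
  LinearMap.pi ![coordR 0, coordR 0 + coordR 1 + coordR 2,
    coordR 0 + (2 : ZMod 3) • coordR 1 + coordR 2]

theorem gray_elemR (a b c : ZMod 3) : gray (elemR a b c) = ![a, a + b + c, a + 2 * b + c] := by
  obtain ⟨h0, h1, h2⟩ := coordR_elemR a b c
  funext j
  fin_cases j <;> simp [gray, h0, h1, h2]

/-- The Gray map `R ^ n → Z₃ ^ (3n)`, in three consecutive blocks of length `n`:
`finProdFinEquiv` sends `(j, i)` to the position `i + n * j`. -/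
def grayVec (n : ℕ) : (Fin n → RingR) →ₗ[ZMod 3] (Fin (3 * n) → ZMod 3) :=
  LinearMap.pi fun t => LinearMap.proj (finProdFinEquiv.symm t).1 ∘ₗ gray ∘ₗ
    LinearMap.proj (finProdFinEquiv.symm t).2

/-- The Gray image of a linear code over `R`, a ternary linear code of length `3n`. -/
def grayCode {n : ℕ} (C : Submodule RingR (Fin n → RingR)) :
    Submodule (ZMod 3) (Fin (3 * n) → ZMod 3) :=
  (C.restrictScalars (ZMod 3)).map (grayVec n)

/-- The Lee weight of a vector over `R`: the sum over the coordinates of the Hamming weights of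
their Gray images. -/
def leeWeight {n : ℕ} (c : Fin n → RingR) : ℕ := ∑ i, hammingNorm (gray (c i))

/-- The minimum Lee weight `d_L` of a (nonzero) linear code: the least Lee weight of a nonzero
codeword. -/
def minLeeWeight {n : ℕ} (C : Submodule RingR (Fin n → RingR)) : ℕ :=
  sInf {w | ∃ c ∈ C, c ≠ 0 ∧ leeWeight c = w}

/-- A linear code over `R` of type `27 ^ k₁ 9 ^ k₂ 3 ^ k₃`. -/
def HasType {n : ℕ} (C : Submodule RingR (Fin n → RingR)) (k₁ k₂ k₃ : ℕ) : Prop :=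
  Nat.card C = 27 ^ k₁ * 9 ^ k₂ * 3 ^ k₃

/-! ### Quantum codes on `N` qutrits -/

/-- The state space `(ℂ³)^{⊗ N}`: a state is given by its amplitudes in the computational basis
`|x⟩`, `x ∈ Z₃ ^ N`. Its inner product is `⟨φ, ψ⟩ = star φ ⬝ᵥ ψ`. -/
abbrev QState (N : ℕ) : Type := (Fin N → ZMod 3) → ℂ

/-- Operators on `N` qutrits, in the computational basis. -/
abbrev QOp (N : ℕ) : Type := Matrix (Fin N → ZMod 3) (Fin N → ZMod 3) ℂ

open Classical in
/-- `E = F ⊗ 1` with `F` an operator on the qutrits in `S`: the error `E` affects only the qutrits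
in `S`. -/
def SupportedOn {N : ℕ} (S : Finset (Fin N)) (E : QOp N) : Prop :=
  ∃ F : Matrix (S → ZMod 3) (S → ZMod 3) ℂ, ∀ x y,
    E x y = if ∀ i, i ∉ S → x i = y i then F (fun i => x i) (fun i => y i) else 0

/-- `Q` is an `[[N, k, d]]₃` quantum error-correcting code: it has dimension `3 ^ k`, and it
detects every error that affects fewer than `d` qutrits, that is `P E P = c P` for a scalar `c`
depending on `E`, where `P` is the orthogonal projection on `Q`. For `k = 0` this detection
condition is empty, and as usual the code is required to be pure, that is `c = tr E / 3 ^ N`. -/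
structure IsQuantumCode (N k d : ℕ) (Q : Submodule ℂ (QState N)) : Prop where
  finrank_eq : Module.finrank ℂ Q = 3 ^ k
  detects : ∀ S : Finset (Fin N), S.card < d → ∀ E : QOp N, SupportedOn S E →
    ∃ c : ℂ, ∀ φ ∈ Q, ∀ ψ ∈ Q, star φ ⬝ᵥ E.mulVec ψ = c * (star φ ⬝ᵥ ψ)
  pure_of_zero : k = 0 → ∀ S : Finset (Fin N), S.card < d → ∀ E : QOp N, SupportedOn S E →
    ∀ φ ∈ Q, ∀ ψ ∈ Q, star φ ⬝ᵥ E.mulVec ψ = E.trace / 3 ^ N * (star φ ⬝ᵥ ψ)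

/-- The CSS code of a ternary linear code `D` with `D^⊥ ⊆ D`: the span of the coset states
`∑_{u ∈ D^⊥} |x + u⟩`, `x ∈ D`. -/
def cssCode {N : ℕ} (D : Submodule (ZMod 3) (Fin N → ZMod 3)) : Submodule ℂ (QState N) :=
  open Classical in
  Submodule.span ℂ {ψ | ∃ x ∈ D, ψ = ∑ u : dualCode D, Pi.single (x + u.1) (1 : ℂ)}

end

noncomputable section

/-! ### Duality of linear codes over `Z₃` -/

/-! Since `v³ - v` has the distinct roots `0, 1, 2` in `Z₃`, evaluation at them identifies `R` with
`Z₃³`; this ring isomorphism is the Gray map. Under it `C` becomes `C₁ × C₂ × C₃` and the form on `R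
^ n` splits into three ternary forms, so `C^⊥ ⊆ C` (`dualCode_le_of_codes`) and the Gray image `D`
satisfies `D^⊥ = φ(C^⊥) ⊆ D` (`dualCode_grayCode`). The Gray map is injective and turns Lee weight
into Hamming weight, which gives the dimension of `D` and the bound `d_L` on its nonzero weights.

For the CSS code, distinct cosets of `D^⊥` in `D` give states with disjoint supports, whence the
dimension. Let `E` act on fewer than `d` positions `S`. Distinct words of `D` differ outside `S`, so
`E` has no matrix entry between them. The diagonal entries of `E` depend only on the restriction to
`S`, and `D^⊥` restricts onto `Z₃ ^ S` because `D` has no nonzero word supported in `S`. Their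
average over any coset of `D^⊥` is therefore `tr E / 3 ^ N`. This one scalar serves both detection
and purity. -/

theorem mem_dualCode {A : Type*} [CommRing A] {m : ℕ} {C : Submodule A (Fin m → A)}
    {x : Fin m → A} : x ∈ dualCode C ↔ ∀ y ∈ C, x ⬝ᵥ y = 0 := Iff.rfl

/-- The standard bilinear form on `K ^ m`. -/
def dotForm (K : Type*) [Field K] (m : ℕ) : LinearMap.BilinForm K (Fin m → K) :=
  dotProductBilin K K

theorem dotForm_apply {K : Type*} [Field K] {m : ℕ} (x y : Fin m → K) :
    dotForm K m x y = x ⬝ᵥ y := rfl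

theorem dotForm_isSymm (K : Type*) [Field K] (m : ℕ) : (dotForm K m).IsSymm :=
  ⟨fun x y => dotProduct_comm x y⟩

theorem dotForm_nondegenerate (K : Type*) [Field K] (m : ℕ) : (dotForm K m).Nondegenerate :=
  ⟨fun x h => dotProduct_eq_zero x h,
    fun x h => dotProduct_eq_zero x fun y => by rw [dotProduct_comm]; exact h y⟩

theorem dualCode_eq_orthogonal {K : Type*} [Field K] {m : ℕ} (D : Submodule K (Fin m → K)) :
    dualCode D = (dotForm K m).orthogonal D := by
  ext x
  simp only [mem_dualCode, LinearMap.BilinForm.mem_orthogonal_iff,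
    dotForm_apply, dotProduct_comm x]

theorem dualCode_dualCode {K : Type*} [Field K] {m : ℕ} (D : Submodule K (Fin m → K)) :
    dualCode (dualCode D) = D := by
  rw [dualCode_eq_orthogonal, dualCode_eq_orthogonal]
  exact LinearMap.BilinForm.orthogonal_orthogonal (dotForm_nondegenerate K m)
    (dotForm_isSymm K m).isRefl D

theorem finrank_dualCode {K : Type*} [Field K] {m : ℕ} (D : Submodule K (Fin m → K)) :
    Module.finrank K (dualCode D) = m - Module.finrank K D := by
  rw [dualCode_eq_orthogonal, LinearMap.BilinForm.finrank_orthogonal (dotForm_nondegenerate K m),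
    Module.finrank_fin_fun]

/-- The restriction of the dual of a code to fewer coordinates than the minimum distance is onto. -/
theorem exists_mem_dualCode_restrict {K : Type*} [Field K] [DecidableEq K] {m d : ℕ}
    {D : Submodule K (Fin m → K)} (hd : ∀ x ∈ D, x ≠ 0 → d ≤ hammingNorm x) {S : Finset (Fin m)}
    (hS : S.card < d) (s : S → K) : ∃ u ∈ dualCode D, ∀ i : S, u i = s i := by
  let ρ : (Fin m → K) →ₗ[K] (S → K) := LinearMap.funLeft K K (fun i : S => (i : Fin m))
  suffices h : (dualCode D).map ρ = ⊤ by
    obtain ⟨u, hu, rfl⟩ : s ∈ (dualCode D).map ρ := h ▸ Submodule.mem_top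
    exact ⟨u, hu, fun i => rfl⟩
  by_contra hne
  obtain ⟨f, hf0, hf⟩ := Submodule.exists_le_ker_of_lt_top _ (lt_top_iff_ne_top.mpr hne)
  -- `z` represents the functional `f ∘ ρ`, which kills `D^⊥`; so `z` is a nonzero word of `D^⊥⊥ =
  -- D` supported in `S`, too light to exist.
  let z : Fin m → K := fun i => f (ρ (Pi.single i 1))
  have hz : ∀ u : Fin m → K, z ⬝ᵥ u = f (ρ u) := by
    intro u
    have hu : u = ∑ i, u i • (Pi.single i 1 : Fin m → K) := pi_eq_sum_univ' u
    conv_rhs => rw [hu]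
    simp [dotProduct, z, mul_comm]
  have hzD : z ∈ D := by
    rw [← dualCode_dualCode D]
    intro u hu
    rw [hz]
    exact hf (Submodule.mem_map_of_mem hu)
  have hz0 : z ≠ 0 := by
    rintro h0
    refine hf0 (LinearMap.ext fun s => ?_)
    obtain ⟨u, rfl⟩ : ∃ u, ρ u = s :=
      LinearMap.funLeft_surjective_of_injective K K _ Subtype.val_injective s
    rw [← hz, h0, zero_dotProduct, LinearMap.zero_apply]
  have hzS : hammingNorm z ≤ S.card := by
    refine Finset.card_le_card fun i hi => ?_
    by_contra hiS
    refine (Finset.mem_filter.mp hi).2 ?_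
    have h0 : ρ (Pi.single i 1) = 0 := by
      funext j
      exact Pi.single_eq_of_ne (fun h : (j : Fin m) = i => hiS (h ▸ j.2)) _
    simp only [z, h0, map_zero]
  have := hd z hzD hz0
  omega

/-- Averaging over a finite group along a surjective homomorphism. -/
theorem card_mul_sum_comp {A B : Type*} [AddCommGroup A] [AddCommGroup B] [Fintype A] [Fintype B]
    (ρ : A →+ B) (hρ : Function.Surjective ρ) (f : B → ℂ) :
    (Fintype.card B : ℂ) * ∑ a, f (ρ a) = Fintype.card A * ∑ b, f b := by
  have h1 : ∀ b, ∑ a, f (ρ a + b) = ∑ a, f (ρ a) := by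
    intro b
    obtain ⟨a₀, rfl⟩ := hρ b
    simp only [← map_add]
    exact Equiv.sum_comp (Equiv.addRight a₀) fun a => f (ρ a)
  have h2 : ∀ a, ∑ b, f (ρ a + b) = ∑ b, f b :=
    fun a => Equiv.sum_comp (Equiv.addLeft (ρ a)) f
  -- Double counting of `∑ f (ρ a + b)`: translation invariance makes each inner sum constant.
  have h3 := Finset.sum_comm (s := Finset.univ) (t := Finset.univ) (f := fun b a => f (ρ a + b))
  simp only [h1, h2, Finset.sum_const, Finset.card_univ, nsmul_eq_mul] at h3
  exact h3

/-! ### The CSS construction -/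

/-- The coset state `∑_{u ∈ D^⊥} |x + u⟩`. -/
def cosetState {N : ℕ} (D : Submodule (ZMod 3) (Fin N → ZMod 3)) (x : Fin N → ZMod 3) :
    QState N :=
  open Classical in ∑ u : dualCode D, Pi.single (x + u.1) (1 : ℂ)

theorem cssCode_eq_span {N : ℕ} (D : Submodule (ZMod 3) (Fin N → ZMod 3)) :
    cssCode D = Submodule.span ℂ {ψ | ∃ x ∈ D, ψ = cosetState D x} := rfl

open Classical in
theorem cosetState_apply {N : ℕ} (D : Submodule (ZMod 3) (Fin N → ZMod 3))
    (x y : Fin N → ZMod 3) : cosetState D x y = if y - x ∈ dualCode D then 1 else 0 := by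
  rw [cosetState, Finset.sum_apply]
  split_ifs with h
  · rw [Finset.sum_eq_single (⟨y - x, h⟩ : dualCode D)]
    · simp
    · intro u _ hu
      refine Pi.single_eq_of_ne (fun h' => hu (Subtype.ext ?_)) _
      simp [h']
    · simp
  · refine Finset.sum_eq_zero fun u _ => Pi.single_eq_of_ne (fun h' => h ?_) _
    simp [h']

theorem cosetState_eq_of_sub_mem {N : ℕ} {D : Submodule (ZMod 3) (Fin N → ZMod 3)}
    {x y : Fin N → ZMod 3} (h : x - y ∈ dualCode D) : cosetState D x = cosetState D y := by
  classical
  funext z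
  rw [cosetState_apply, cosetState_apply]
  have : z - x ∈ dualCode D ↔ z - y ∈ dualCode D := by
    rw [← sub_add_sub_cancel z x y]
    exact ((dualCode D).add_mem_iff_left h).symm
  simp only [this]

theorem finrank_cssCode {N : ℕ} {D : Submodule (ZMod 3) (Fin N → ZMod 3)} (hD : dualCode D ≤ D) :
    Module.finrank ℂ (cssCode D) = 3 ^ (2 * Module.finrank (ZMod 3) D - N) := by
  classical
  let U : Submodule (ZMod 3) D := (dualCode D).comap D.subtype
  have hout : ∀ x : D, x.1 - (Submodule.Quotient.mk (p := U) x).out.1 ∈ dualCode D := by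
    intro x
    have := (Submodule.Quotient.eq U (x := x) (y := (Submodule.Quotient.mk (p := U) x).out)).mp
      (Quotient.out_eq _).symm
    exact this
  let v : D ⧸ U → QState N := fun q => cosetState D q.out.1
  -- Evaluation at the chosen representatives is dual to the family `v`, so independence can be read
  -- off coordinates.
  have hv : ∀ q q' : D ⧸ U, v q' q.out.1 = if q = q' then 1 else 0 := by
    intro q q'
    simp only [v, cosetState_apply]
    have : q.out.1 - q'.out.1 ∈ dualCode D ↔ q = q' := by
      rw [← Quotient.out_eq q, ← Quotient.out_eq q']
      simp only [Quotient.out_eq]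
      conv_rhs => rw [← Quotient.out_eq q, ← Quotient.out_eq q']
      exact (Submodule.Quotient.eq U).symm
    simp only [this]
  have hli : LinearIndependent ℂ v := by
    rw [Fintype.linearIndependent_iff]
    intro g hg q
    have := congrFun hg q.out.1
    simpa [Finset.sum_apply, hv] using this
  have hspan : cssCode D = Submodule.span ℂ (Set.range v) := by
    rw [cssCode_eq_span]
    congr 1
    ext ψ
    constructor
    · rintro ⟨x, hx, rfl⟩
      exact ⟨Submodule.Quotient.mk ⟨x, hx⟩, (cosetState_eq_of_sub_mem (hout ⟨x, hx⟩)).symm⟩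
    · rintro ⟨q, rfl⟩
      exact ⟨_, q.out.2, rfl⟩
  rw [hspan, finrank_span_eq_card hli, Module.card_eq_pow_finrank (K := ZMod 3), ZMod.card,
    Submodule.finrank_quotient, (Submodule.comapSubtypeEquivOfLe hD).finrank_eq, finrank_dualCode]
  congr 1
  -- With truncated subtraction, `k - (N - k) = 2 * k - N` needs `k ≤ N`.
  have := D.finrank_le
  rw [Module.finrank_fin_fun] at this
  omega

theorem star_cosetState_dotProduct_mulVec {N : ℕ} (D : Submodule (ZMod 3) (Fin N → ZMod 3))
    (x y : Fin N → ZMod 3) (E : QOp N) : open Classical in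
    star (cosetState D x) ⬝ᵥ E.mulVec (cosetState D y)
      = ∑ u : dualCode D, ∑ w : dualCode D, E (x + u.1) (y + w.1) := by
  classical
  have hs : star (cosetState D x) = cosetState D x := by
    funext z
    rw [Pi.star_apply, cosetState_apply]
    split_ifs <;> simp
  rw [hs]
  simp only [cosetState, sum_dotProduct, single_one_dotProduct]
  refine Finset.sum_congr rfl fun u _ => ?_
  simp only [Matrix.mulVec, dotProduct_sum, dotProduct_single_one]

theorem SupportedOn.apply_eq_zero {N : ℕ} {S : Finset (Fin N)} {E : QOp N} (hE : SupportedOn S E)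
    {x y : Fin N → ZMod 3} {i : Fin N} (hi : i ∉ S) (hxy : x i ≠ y i) : E x y = 0 := by
  obtain ⟨F, hF⟩ := hE
  rw [hF, if_neg fun h => hxy (h i hi)]

/-- The sum of the diagonal entries of a local error over a coset of the dual code. -/
theorem SupportedOn.sum_dualCode_diag {N d : ℕ} {D : Submodule (ZMod 3) (Fin N → ZMod 3)}
    (hd : ∀ x ∈ D, x ≠ 0 → d ≤ hammingNorm x) {S : Finset (Fin N)} (hS : S.card < d) {E : QOp N}
    (hE : SupportedOn S E) (x : Fin N → ZMod 3) : open Classical in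
    ∑ u : dualCode D, E (x + u.1) (x + u.1)
      = E.trace / 3 ^ N * Fintype.card (dualCode D) := by
  classical
  obtain ⟨F, hF⟩ := hE
  let ρ : (Fin N → ZMod 3) →ₗ[ZMod 3] (S → ZMod 3) :=
    LinearMap.funLeft (ZMod 3) (ZMod 3) (fun i : S => (i : Fin N))
  have hdiag : ∀ y, E y y = F (ρ y) (ρ y) := fun y => by
    rw [hF, if_pos fun _ _ => rfl]; rfl
  have h1 := card_mul_sum_comp ρ.toAddMonoidHom
    (LinearMap.funLeft_surjective_of_injective (ZMod 3) (ZMod 3) (fun i : S => (i : Fin N))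
      Subtype.val_injective) (fun s => F s s)
  -- `h1` averages over the whole space, `h2` over `D^⊥`; both reduce to the same sum over `Z₃ ^ S`,
  -- which is eliminated at the end.
  have h2 := card_mul_sum_comp (ρ ∘ₗ (dualCode D).subtype).toAddMonoidHom
    (fun s => by
      obtain ⟨u, hu, h⟩ := exists_mem_dualCode_restrict hd hS s
      exact ⟨⟨u, hu⟩, funext h⟩) (fun s => F (ρ x + s) (ρ x + s))
  have h3 : ∑ s, F (ρ x + s) (ρ x + s) = ∑ s, F s s :=
    Equiv.sum_comp (Equiv.addLeft (ρ x)) fun s => F s s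
  rw [h3] at h2
  have htr : E.trace = ∑ a, F (ρ a) (ρ a) := Finset.sum_congr rfl fun a _ => hdiag a
  have hsum : ∑ u : dualCode D, E (x + u.1) (x + u.1)
      = ∑ u : dualCode D, F (ρ x + ρ u.1) (ρ x + ρ u.1) :=
    Finset.sum_congr rfl fun u _ => by rw [hdiag, map_add]
  rw [htr, hsum]
  simp only [LinearMap.toAddMonoidHom_coe, LinearMap.comp_apply, Submodule.subtype_apply,
    Fintype.card_fun, ZMod.card, Fintype.card_fin, Nat.cast_pow, Nat.cast_ofNat] at h1 h2
  have hne : (3 : ℂ) ^ Fintype.card S ≠ 0 := pow_ne_zero _ three_ne_zero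
  rw [div_mul_eq_mul_div, eq_div_iff (pow_ne_zero _ three_ne_zero)]
  apply mul_left_cancel₀ hne
  linear_combination (3 : ℂ) ^ N * h2 - (Fintype.card (dualCode D) : ℂ) * h1

theorem SupportedOn.star_cosetState_dotProduct_mulVec {N d : ℕ}
    {D : Submodule (ZMod 3) (Fin N → ZMod 3)} (hD : dualCode D ≤ D)
    (hd : ∀ x ∈ D, x ≠ 0 → d ≤ hammingNorm x) {S : Finset (Fin N)} (hS : S.card < d) {E : QOp N}
    (hE : SupportedOn S E) {x y : Fin N → ZMod 3} (hx : x ∈ D) (hy : y ∈ D) :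
    star (cosetState D x) ⬝ᵥ E.mulVec (cosetState D y)
      = E.trace / 3 ^ N * (star (cosetState D x) ⬝ᵥ cosetState D y) := by
  classical
  -- `a - b` has weight at least `d > |S|`, so `a` and `b` differ at a position that `E` leaves
  -- untouched.
  have hoff : ∀ a ∈ D, ∀ b ∈ D, a ≠ b → E a b = 0 := by
    intro a ha b hb hab
    have hw := hd (a - b) (D.sub_mem ha hb) (sub_ne_zero.mpr hab)
    obtain ⟨i, hi, hiS⟩ := Finset.exists_mem_notMem_of_card_lt_card (hS.trans_le hw)
    exact hE.apply_eq_zero hiS (sub_ne_zero.mp (Finset.mem_filter.mp hi).2)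
  have hone : cosetState D y = (1 : QOp N).mulVec (cosetState D y) := (Matrix.one_mulVec _).symm
  by_cases hxy : y - x ∈ dualCode D
  · rw [cosetState_eq_of_sub_mem hxy]
    -- Used for `G = E` and for `G = 1`, which gives the squared norm of the coset state.
    have hcol : ∀ G : QOp N, (∀ a ∈ D, ∀ b ∈ D, a ≠ b → G a b = 0) →
        star (cosetState D x) ⬝ᵥ G.mulVec (cosetState D x)
          = ∑ u : dualCode D, G (x + u.1) (x + u.1) := by
      intro G hG
      rw [_root_.star_cosetState_dotProduct_mulVec]
      refine Finset.sum_congr rfl fun u _ => Finset.sum_eq_single u (fun w _ hw => ?_) (by simp)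
      exact hG _ (D.add_mem hx (hD u.2)) _ (D.add_mem hx (hD w.2))
        fun h => hw (Subtype.ext (add_left_cancel h).symm)
    have h1 := hcol 1 fun a _ b _ hab => Matrix.one_apply_ne hab
    rw [Matrix.one_mulVec] at h1
    rw [hcol E hoff, h1, hE.sum_dualCode_diag hd hS x]
    simp
  · have hne : ∀ u w : dualCode D, x + u.1 ≠ y + w.1 := by
      intro u w h
      refine hxy ?_
      rw [show y - x = u.1 - w.1 by rw [sub_eq_sub_iff_add_eq_add, ← h, add_comm]]
      exact Submodule.sub_mem _ u.2 w.2
    have h1 := _root_.star_cosetState_dotProduct_mulVec D x y (1 : QOp N)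
    rw [Matrix.one_mulVec] at h1
    rw [_root_.star_cosetState_dotProduct_mulVec, h1]
    simp only [Matrix.one_apply_ne (hne _ _), hoff _ (D.add_mem hx (hD (Subtype.prop _))) _
      (D.add_mem hy (hD (Subtype.prop _))) (hne _ _), Finset.sum_const_zero, mul_zero]

/-- A CSS code is pure up to the minimum distance of the classical code. -/
theorem SupportedOn.star_dotProduct_mulVec_of_mem_cssCode {N d : ℕ}
    {D : Submodule (ZMod 3) (Fin N → ZMod 3)} (hD : dualCode D ≤ D)
    (hd : ∀ x ∈ D, x ≠ 0 → d ≤ hammingNorm x) {S : Finset (Fin N)} (hS : S.card < d) {E : QOp N}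
    (hE : SupportedOn S E) {φ ψ : QState N} (hφ : φ ∈ cssCode D) (hψ : ψ ∈ cssCode D) :
    star φ ⬝ᵥ E.mulVec ψ = E.trace / 3 ^ N * (star φ ⬝ᵥ ψ) := by
  rw [cssCode_eq_span] at hφ hψ
  induction hφ, hψ using Submodule.span_induction₂ with
  | mem_mem φ ψ hφ hψ =>
    obtain ⟨x, hx, rfl⟩ := hφ
    obtain ⟨y, hy, rfl⟩ := hψ
    exact hE.star_cosetState_dotProduct_mulVec hD hd hS hx hy
  | zero_left ψ => simp
  | zero_right φ => simp
  | add_left φ φ' ψ _ _ _ h h' => simp only [star_add, add_dotProduct, h, h', mul_add]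
  | add_right φ ψ ψ' _ _ _ h h' => simp only [Matrix.mulVec_add, dotProduct_add, h, h', mul_add]
  | smul_left r φ ψ _ _ h => simp only [star_smul, smul_dotProduct, h, smul_eq_mul]; ring
  | smul_right r φ ψ _ _ h => simp only [Matrix.mulVec_smul, dotProduct_smul, h, smul_eq_mul]; ring

theorem isQuantumCode_cssCode {N d : ℕ} {D : Submodule (ZMod 3) (Fin N → ZMod 3)}
    (hD : dualCode D ≤ D) (hd : ∀ x ∈ D, x ≠ 0 → d ≤ hammingNorm x) :
    IsQuantumCode N (2 * Module.finrank (ZMod 3) D - N) d (cssCode D) where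
  finrank_eq := finrank_cssCode hD
  detects _ hS E hE := ⟨E.trace / 3 ^ N, fun _ hφ _ hψ =>
    hE.star_dotProduct_mulVec_of_mem_cssCode hD hd hS hφ hψ⟩
  pure_of_zero _ _ hS _ hE _ hφ _ hψ :=
    hE.star_dotProduct_mulVec_of_mem_cssCode hD hd hS hφ hψ

/-! ### The Gray map as a ring isomorphism -/

/-- Exhibits Gray coordinate `j` as evaluation at `v = j`; for `j = 2` this uses `4 = 1`. -/
theorem gray_elemR_apply (a b c : ZMod 3) (j : Fin 3) :
    gray (elemR a b c) j = a + ((j : ℕ) : ZMod 3) * b + ((j : ℕ) : ZMod 3) ^ 2 * c := by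
  rw [gray_elemR]
  fin_cases j
  · simp
  · simp
  · have h : (2 : ZMod 3) ^ 2 = 1 := rfl
    simp [h]

theorem elemR_mul (a b c a' b' c' : ZMod 3) :
    elemR a b c * elemR a' b' c' = elemR (a * a') (a * b' + b * a' + b * c' + c * b')
      (a * c' + b * b' + c * a' + c * c') := by
  simp only [elemR, map_add, map_mul]
  generalize algebraMap (ZMod 3) RingR a = A
  generalize algebraMap (ZMod 3) RingR b = B
  generalize algebraMap (ZMod 3) RingR c = D
  generalize algebraMap (ZMod 3) RingR a' = A'
  generalize algebraMap (ZMod 3) RingR b' = B'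
  generalize algebraMap (ZMod 3) RingR c' = D'
  linear_combination (B * D' + D * B' + vR * D * D') * vR_cube

theorem gray_mul (r s : RingR) : gray (r * s) = gray r * gray s := by
  rw [← elemR_coord r, ← elemR_coord s, elemR_mul]
  funext j
  -- By Fermat `j` is a root of `v³ - v`, so evaluation at it respects products in `R`.
  have hj : ((j : ℕ) : ZMod 3) ^ 3 = ((j : ℕ) : ZMod 3) := ZMod.pow_card _
  simp only [Pi.mul_apply, gray_elemR_apply]
  generalize coordR 0 r = a
  generalize coordR 1 r = b
  generalize coordR 2 r = c
  generalize coordR 0 s = a'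
  generalize coordR 1 s = b'
  generalize coordR 2 s = c'
  linear_combination -(b * c' + c * b' + ((j : ℕ) : ZMod 3) * c * c') * hj

/-- Lagrange interpolation: the coefficients are the idempotents equal to `1` at one of `0, 1, 2`
and to `0` at the other two. -/
theorem gray_decomposition (r : RingR) :
    r = (1 + 2 * vR ^ 2) * algebraMap (ZMod 3) RingR (gray r 0)
      + (2 * vR + 2 * vR ^ 2) * algebraMap (ZMod 3) RingR (gray r 1)
      + (vR + 2 * vR ^ 2) * algebraMap (ZMod 3) RingR (gray r 2) := by
  obtain ⟨a, b, c, rfl⟩ : ∃ a b c, elemR a b c = r := ⟨_, _, _, elemR_coord r⟩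
  rw [gray_elemR]
  simp only [elemR, Matrix.cons_val, map_add, map_mul, map_ofNat]
  generalize algebraMap (ZMod 3) RingR a = A
  generalize algebraMap (ZMod 3) RingR b = B
  generalize algebraMap (ZMod 3) RingR c = D
  linear_combination (-(A * vR) - 2 * A * vR ^ 2 - B * vR - 2 * B * vR ^ 2 - D * vR
    - D * vR ^ 2) * three_R

theorem gray_injective : Function.Injective gray := by
  intro r s h
  rw [gray_decomposition r, gray_decomposition s, h]

theorem gray_surjective : Function.Surjective gray := by
  intro x
  -- The interpolation formula with values `x 0, x 1, x 2`, expanded in powers of `v`.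
  refine ⟨elemR (x 0) (2 * x 1 + x 2) (2 * x 0 + 2 * x 1 + 2 * x 2), ?_⟩
  have h3 : (3 : ZMod 3) = 0 := rfl
  rw [gray_elemR]
  funext j
  fin_cases j
  · rfl
  · simp only [Fin.mk_one, Matrix.cons_val]
    linear_combination (x 0 + x 1 + x 2) * h3
  · simp only [Fin.reduceFinMk, Matrix.cons_val]
    linear_combination (x 0 + 2 * x 1 + x 2) * h3

theorem gray_dotProduct {n : ℕ} (x y : Fin n → RingR) (j : Fin 3) :
    gray (x ⬝ᵥ y) j = (fun i => gray (x i) j) ⬝ᵥ (fun i => gray (y i) j) := by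
  simp only [dotProduct, map_sum, Finset.sum_apply, gray_mul, Pi.mul_apply]

theorem grayVec_apply {n : ℕ} (x : Fin n → RingR) (j : Fin 3) (i : Fin n) :
    grayVec n x (finProdFinEquiv (j, i)) = gray (x i) j := by
  simp only [grayVec, LinearMap.pi_apply, LinearMap.comp_apply, LinearMap.proj_apply,
    Equiv.symm_apply_apply]

theorem grayVec_injective (n : ℕ) : Function.Injective (grayVec n) := by
  intro x y h
  funext i
  refine gray_injective (funext fun j => ?_)
  rw [← grayVec_apply, h, grayVec_apply]

theorem grayVec_surjective (n : ℕ) : Function.Surjective (grayVec n) := by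
  intro t
  choose x hx using fun i : Fin n => gray_surjective fun j => t (finProdFinEquiv (j, i))
  refine ⟨x, funext fun k => ?_⟩
  obtain ⟨⟨j, i⟩, rfl⟩ := finProdFinEquiv.surjective k
  rw [grayVec_apply, hx]

theorem grayVec_dotProduct {n : ℕ} (x y : Fin n → RingR) :
    grayVec n x ⬝ᵥ grayVec n y = ∑ j, gray (x ⬝ᵥ y) j := by
  rw [dotProduct, ← finProdFinEquiv.sum_comp, Fintype.sum_prod_type]
  refine Finset.sum_congr rfl fun j _ => ?_
  rw [gray_dotProduct]
  simp only [grayVec_apply, dotProduct]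

theorem hammingNorm_grayVec {n : ℕ} (x : Fin n → RingR) :
    hammingNorm (grayVec n x) = leeWeight x := by
  simp only [leeWeight, hammingNorm, Finset.card_filter]
  rw [← finProdFinEquiv.sum_comp, Fintype.sum_prod_type, Finset.sum_comm]
  simp only [grayVec_apply]

/-! ### Linear codes over `R` and their Gray images -/

theorem gray_mem_codes {n : ℕ} {C : Submodule RingR (Fin n → RingR)} {w : Fin n → RingR}
    (hw : w ∈ C) : (fun i => gray (w i) 0) ∈ code1 C ∧ (fun i => gray (w i) 1) ∈ code2 C ∧
      (fun i => gray (w i) 2) ∈ code3 C := by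
  have hw' : vecR (fun i => coordR 0 (w i)) (fun i => coordR 1 (w i)) (fun i => coordR 2 (w i))
      ∈ C := by
    convert hw using 1
    funext i
    exact elemR_coord (w i)
  exact ⟨⟨_, _, hw'⟩, ⟨_, _, _, hw', rfl⟩, ⟨_, _, _, hw', rfl⟩⟩

theorem mem_of_gray_mem_codes {n : ℕ} {C : Submodule RingR (Fin n → RingR)} {w : Fin n → RingR}
    (h₁ : (fun i => gray (w i) 0) ∈ code1 C) (h₂ : (fun i => gray (w i) 1) ∈ code2 C)
    (h₃ : (fun i => gray (w i) 2) ∈ code3 C) : w ∈ C :=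
  (mem_iff_decomposition C w).mpr
    ⟨_, h₁, _, h₂, _, h₃, funext fun i => gray_decomposition (w i)⟩

theorem exists_mem_gray_of_mem_code1 {n : ℕ} {C : Submodule RingR (Fin n → RingR)}
    {x : Fin n → ZMod 3} (hx : x ∈ code1 C) : ∃ y ∈ C, x = fun i => gray (y i) 0 := by
  obtain ⟨b, c, h⟩ := hx
  exact ⟨_, h, funext fun i => by simp [vecR, gray_elemR]⟩

theorem exists_mem_gray_of_mem_code2 {n : ℕ} {C : Submodule RingR (Fin n → RingR)}
    {x : Fin n → ZMod 3} (hx : x ∈ code2 C) : ∃ y ∈ C, x = fun i => gray (y i) 1 := by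
  obtain ⟨a, b, c, h, rfl⟩ := hx
  exact ⟨_, h, funext fun i => by simp [vecR, gray_elemR]⟩

theorem exists_mem_gray_of_mem_code3 {n : ℕ} {C : Submodule RingR (Fin n → RingR)}
    {x : Fin n → ZMod 3} (hx : x ∈ code3 C) : ∃ y ∈ C, x = fun i => gray (y i) 2 := by
  obtain ⟨a, b, c, h, rfl⟩ := hx
  exact ⟨_, h, funext fun i => by simp [vecR, gray_elemR]⟩

/-- A code over `R` contains its dual if its three ternary components do. -/
theorem dualCode_le_of_codes {n : ℕ} {C : Submodule RingR (Fin n → RingR)}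
    (h₁ : dualCode (code1 C) ≤ code1 C) (h₂ : dualCode (code2 C) ≤ code2 C)
    (h₃ : dualCode (code3 C) ≤ code3 C) : dualCode C ≤ C := by
  intro x hx
  have hxy : ∀ y ∈ C, ∀ j, (fun i => gray (x i) j) ⬝ᵥ (fun i => gray (y i) j) = 0 := by
    intro y hy j
    rw [← gray_dotProduct, hx y hy, map_zero, Pi.zero_apply]
  refine mem_of_gray_mem_codes (h₁ fun a ha => ?_) (h₂ fun a ha => ?_) (h₃ fun a ha => ?_)
  · obtain ⟨y, hy, rfl⟩ := exists_mem_gray_of_mem_code1 ha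
    exact hxy y hy 0
  · obtain ⟨y, hy, rfl⟩ := exists_mem_gray_of_mem_code2 ha
    exact hxy y hy 1
  · obtain ⟨y, hy, rfl⟩ := exists_mem_gray_of_mem_code3 ha
    exact hxy y hy 2

/-- The dual of the Gray image is the Gray image of the dual. -/
theorem dualCode_grayCode {n : ℕ} (C : Submodule RingR (Fin n → RingR)) :
    dualCode (grayCode C) = grayCode (dualCode C) := by
  ext t
  constructor
  · intro ht
    obtain ⟨x, rfl⟩ := grayVec_surjective n t
    refine ⟨x, fun y hy => gray_injective (funext fun j => ?_), rfl⟩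
    -- Orthogonality of Gray images only kills the sum of the three components of `x ⬝ᵥ y`.
    -- Replacing `y` by `e • y`, with `e` the `j`-th idempotent, isolates component `j`.
    obtain ⟨e, he⟩ := gray_surjective (Pi.single j 1)
    have h := ht (grayVec n (e • y)) ⟨e • y, C.smul_mem e hy, rfl⟩
    rw [grayVec_dotProduct, dotProduct_smul, smul_eq_mul, gray_mul, he] at h
    simpa [Pi.single_apply] using h
  · rintro ⟨x, hx, rfl⟩ _ ⟨y, hy, rfl⟩
    rw [grayVec_dotProduct, hx y hy]
    simp

theorem minLeeWeight_le_hammingNorm {n : ℕ} {C : Submodule RingR (Fin n → RingR)}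
    {t : Fin (3 * n) → ZMod 3} (ht : t ∈ grayCode C) (h0 : t ≠ 0) :
    minLeeWeight C ≤ hammingNorm t := by
  obtain ⟨x, hx, rfl⟩ := ht
  rw [hammingNorm_grayVec]
  exact Nat.sInf_le ⟨x, hx, fun h => h0 (by rw [h, map_zero]), rfl⟩

/-- Injectivity of the Gray map preserves cardinality, so exponents of `3` can be compared. -/
theorem HasType.finrank_grayCode {n : ℕ} {C : Submodule RingR (Fin n → RingR)} {k₁ k₂ k₃ : ℕ}
    (h : HasType C k₁ k₂ k₃) :
    Module.finrank (ZMod 3) (grayCode C) = 3 * k₁ + 2 * k₂ + k₃ := by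
  have hcard : Nat.card (grayCode C) = Nat.card C :=
    (Nat.card_congr (Submodule.equivMapOfInjective (grayVec n) (grayVec_injective n)
      (C.restrictScalars (ZMod 3))).toEquiv).symm
  rw [HasType, ← hcard, Module.natCard_eq_pow_finrank (K := ZMod 3), Nat.card_zmod,
    show 27 = 3 ^ 3 from rfl, show 9 = 3 ^ 2 from rfl, ← pow_mul, ← pow_mul, ← pow_add,
    ← pow_add] at h
  exact Nat.pow_right_injective (by norm_num : 2 ≤ 3) h

end

theorem theorem27 (n : ℕ) [NeZero n] (C : Submodule RingR (Fin n → RingR)) (k₁ k₂ k₃ : ℕ)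
    (hcyc : IsCyclicCode C ∨ IsNegacyclicCode C)
    (htype : HasType C k₁ k₂ k₃)
    (h₁ : dualCode (code1 C) ≤ code1 C)
    (h₂ : dualCode (code2 C) ≤ code2 C)
    (h₃ : dualCode (code3 C) ≤ code3 C) :
    dualCode C ≤ C ∧
      3 * n ≤ 2 * (3 * k₁ + 2 * k₂ + k₃) ∧
      dualCode (grayCode C) ≤ grayCode C ∧
      IsQuantumCode (3 * n) (2 * (3 * k₁ + 2 * k₂ + k₃) - 3 * n) (minLeeWeight C)
        (cssCode (grayCode C)) := by
  have hC := dualCode_le_of_codes h₁ h₂ h₃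
  have hG : dualCode (grayCode C) ≤ grayCode C := by
    rw [dualCode_grayCode]
    exact Submodule.map_mono hC
  have hk := htype.finrank_grayCode
  refine ⟨hC, ?_, hG, ?_⟩
  -- `D^⊥ ⊆ D` forces `3n - dim D ≤ dim D`.
  · have h := Submodule.finrank_mono hG
    rw [finrank_dualCode, hk] at h
    omega
  · rw [← hk]
    exact isQuantumCode_cssCode hG fun t ht h0 => minLeeWeight_le_hammingNorm ht h0
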